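/- **Notation.** For a square complex matrix $S$, a vector $c$ and a list of poles $\zeta=[\zeta_0,\dots,\zeta_{\ell-1}]\subset\mathbb C\cup\{\infty\}$, none of whose finite entries is an eigenvalue of $S$, let $\mathcal Q(S,c,\zeta)=\{q(S)^{-1}p(S)c:\ \deg p\le \ell-1\}$ with $q(x)=\prod_{\zeta_j\neq\infty}(x-\zeta_j)$ be the rational Krylov space. For a rational function $f=p/q$ put $f(S)=p(S)q(S)^{-1}$. $\|\cdot\|$ is the Euclidean norm and $e_1$ the first unit vector. **Data.** Let $A\in\mathbb C^{n\times n}$ be Hermitian, $b\in\mathbb C^n$, $k,m\ge 1$, $M=k+sm$. Let $\theta_0,\dots,\theta_{M-1}\in\mathbb C\cup\{\infty\}$ be outer poles, the finite ones not eigenvalues of $A$, with $\theta_0=\infty$ and $\theta_{k+im}=\infty$ for $1\le i\le s-1$; put $\boldsymbol\theta_\ell=[\theta_0,\dots,\theta_{\ell-1}]$. Let $q_1,\dots,q_M$ be the basis generated by the rational Lanczos algorithm, i.e. $q_1=b/\|b\|$ and, for every $\ell\le M$, $\mathbf Q_\ell=[q_1,\dots,q_\ell]$ is an orthonormal basis of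 $\mathcal Q(A,b,\boldsymbol\theta_\ell)$; put $\mathbf T_\ell=\mathbf Q_\ell^HA\mathbf Q_\ell$. Let $\boldsymbol\xi=[\xi_0,\dots,\xi_{k-1}]\subset\mathbb C\cup\{\infty\}$ be a list of inner poles closed (with multiplicity) under complex conjugation, and let $f=p/q$ with $\deg p\le k-1$ and $q(x)=\prod_{\xi_j\ne\infty}(x-\xi_j)$. **Algorithm.** Let $Q_1=[q_1,\dots,q_{k+m}]$, $Q_i=[q_{k+(i-1)m+1},\dots,q_{k+im}]$ for $2\le i\le s$, and $T_i=Q_i^HAQ_i$, and for $1\le i\le s-1$ let $b_i=Q_i^HAq_{k+im+1}$. Start with $V_1=Q_1$, $S_1=T_1$, $v_1=e_1\|b\|$, $\tilde b_1=b_1$, $y_1=Q_1f(T_1)e_1\|b\|$. For $i=2,\dots,s$ let $U_{i-1}\in\mathbb C^{(k+m)\times k}$ be any orthonormal basis of $\mathcal Q(S_{i-1},\tilde b_{i-1},\boldsymbol\xi)$ and set $$w_{i-1}=-V_{i-1}U_{i-1}f(U_{i-1}^HS_{i-1}U_{i-1})U_{i-1}^Hv_{i-1},\quad V_i=[V_{i-1}U_{i-1}\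 \ Q_i],\quad v_i=\begin{bmatrix}U_{i-1}^Hv_{i-1}\\0\end{bmatrix},$$ $$S_i=\begin{bmatrix}U_{i-1}^HS_{i-1}U_{i-1}&U_{i-1}^H\tilde b_{i-1}e_1^H\\ e_1\tilde b_{i-1}^HU_{i-1}&T_i\end{bmatrix},\quad y_i=y_{i-1}+w_{i-1}+V_if(S_i)v_i,$$ and, if $i<s$, $\tilde b_i=\begin{bmatrix}0\\b_i\end{bmatrix}$. Assume the matrix functions involved are defined: no finite inner pole is an eigenvalue of $\mathbf T_{k+im}$ or $S_i$ ($1\le i\le s$) or of $U_i^HS_iU_i$ ($1\le i\le s-1$). **Proposition.** For every $i=1,\dots,s$, $$y_i=\mathbf Q_{k+im}\,f(\mathbf T_{k+im})\,e_1\|b\| .$$ -/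

import Mathlib

open Matrix Polynomial

noncomputable section

namespace RKCompress

/-- The factor contributed by a pole to a denominator polynomial:
`X - z` for a finite pole `z`, and `1` for the pole at infinity. -/
def poleFactor (z : OnePoint ℂ) : ℂ[X] := z.elim 1 fun w => X - C w

/-- `q(x) = ∏ (x - ξ)`, the product running over the finite entries `ξ` of the list of poles. -/
def poleProd {l : ℕ} (ξ : Fin l → OnePoint ℂ) : ℂ[X] := ∏ j, poleFactor (ξ j)

/-- No finite entry of the list `ξ` is an eigenvalue of the matrix `A`. -/
def PolesAvoid {ι : Type*} [Fintype ι] [DecidableEq ι] {l : ℕ}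
    (ξ : Fin l → OnePoint ℂ) (A : Matrix ι ι ℂ) : Prop :=
  ∀ (j : Fin l) (z : ℂ), ξ j = (z : OnePoint ℂ) → z ∉ spectrum ℂ A

/-- The list `ξ` is closed under complex conjugation, with multiplicities (`∞` is self-conjugate). -/
def ConjClosed {l : ℕ} (ξ : Fin l → OnePoint ℂ) : Prop :=
  ∃ σ : Equiv.Perm (Fin l), ∀ j, ξ (σ j) = (ξ j).map (starRingEnd ℂ)

/-- The rational Krylov space `{q(A)⁻¹ p(A) b : deg p ≤ l - 1}` of a list of `l` poles
(to be used when no finite pole is an eigenvalue of `A`). -/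
def ratKrylov {ι : Type*} [Fintype ι] [DecidableEq ι] {l : ℕ}
    (A : Matrix ι ι ℂ) (b : ι → ℂ) (ξ : Fin l → OnePoint ℂ) : Set (ι → ℂ) :=
  {v | ∃ p ∈ Polynomial.degreeLT ℂ l, v = (aeval A (poleProd ξ))⁻¹ *ᵥ (aeval A p *ᵥ b)}

/-- The columns of `Q` are orthonormal and their linear span is `W`. -/
def IsOrthonormalBasisOf {ι κ : Type*} [Fintype ι] [Fintype κ] [DecidableEq κ]
    (Q : Matrix ι κ ℂ) (W : Set (ι → ℂ)) : Prop :=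
  Qᴴ * Q = 1 ∧ Set.range (fun c : κ → ℂ => Q *ᵥ c) = W

/-- The matrix function `f(A) = p(A) q(A)⁻¹` of a rational function `f = p / q` in lowest terms
(to be used when no pole of `f` is an eigenvalue of `A`). -/
def ratFun {ι : Type*} [Fintype ι] [DecidableEq ι] (f : RatFunc ℂ) (A : Matrix ι ι ℂ) :
    Matrix ι ι ℂ :=
  aeval A f.num * (aeval A f.denom)⁻¹

/-- `f` is a rational function of type `(k - 1, k)` with poles given by the list `ξ` of length `k`:
`f = p / q` with `deg p ≤ k - 1` and `q` the product of `x - ξ_j` over the finite poles. -/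
def HasTypeWithPoles {k : ℕ} (f : RatFunc ℂ) (ξ : Fin k → OnePoint ℂ) : Prop :=
  ∃ p ∈ Polynomial.degreeLT ℂ k,
    f = algebraMap ℂ[X] (RatFunc ℂ) p / algebraMap ℂ[X] (RatFunc ℂ) (poleProd ξ)

/-- The Euclidean norm of a vector. -/
def norm2 {ι : Type*} [Fintype ι] (v : ι → ℂ) : ℝ := ‖WithLp.toLp 2 v‖

/-- The list `[θ_0, …, θ_{l-1}]`. -/
def poleList (θ : ℕ → OnePoint ℂ) (l : ℕ) : Fin l → OnePoint ℂ := fun j => θ j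

/-- The matrix `Q_l = [q_0, …, q_{l-1}]` of the first `l` vectors. -/
def leadCols {n : ℕ} (q : ℕ → Fin n → ℂ) (l : ℕ) : Matrix (Fin n) (Fin l) ℂ :=
  Matrix.of fun r j => q j r

/-- `q_0, …, q_{M-1}` is an orthonormal basis as generated (in exact arithmetic) by the rational
Lanczos / rational Arnoldi algorithm for `A`, `b` and the poles `θ_0 = ∞, θ_1, …, θ_{M-1}`:
it starts with `b / ‖b‖`, and for each `l ≤ M` the first `l` vectors form an orthonormal basis of
the rational Krylov space of the poles `[θ_0, …, θ_{l-1}]`. The entries of `q` and `θ` at indices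
`≥ M` play no role. -/
def IsRationalLanczosBasis {n : ℕ} (A : Matrix (Fin n) (Fin n) ℂ) (b : Fin n → ℂ)
    (θ : ℕ → OnePoint ℂ) (M : ℕ) (q : ℕ → Fin n → ℂ) : Prop :=
  q 0 = ((norm2 b : ℂ)⁻¹) • b ∧
    ∀ l ≤ M, IsOrthonormalBasisOf (leadCols q l) (ratKrylov A b (poleList θ l))

/-- The projection `T_l = Q_lᴴ A Q_l`. -/
def projMat {n : ℕ} (A : Matrix (Fin n) (Fin n) ℂ) (q : ℕ → Fin n → ℂ) (l : ℕ) :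
    Matrix (Fin l) (Fin l) ℂ :=
  (leadCols q l)ᴴ * A * leadCols q l

/-- The rational Lanczos approximation `Q_l f(T_l) e₁ ‖b‖` of `f(A) b`, for `l ≥ 1`
(`e₁` is the vector with entry `1` at index `0`). -/
def lanczosApprox {n : ℕ} (A : Matrix (Fin n) (Fin n) ℂ) (b : Fin n → ℂ) (f : RatFunc ℂ)
    (q : ℕ → Fin n → ℂ) (l : ℕ) : Fin n → ℂ :=
  leadCols q l *ᵥ
    (ratFun f (projMat A q l) *ᵥ fun j : Fin l => if (j : ℕ) = 0 then (norm2 b : ℂ) else 0)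

/-- What the compressed algorithm holds in one cycle: the basis `V`, the projected matrix `S`, the
coordinate vector `v`, the coupling vector `bt` (written `b̃` in formulas) and the iterate `y`.
The `k + m` coordinates are indexed by `Fin k ⊕ Fin m`, the first `k` followed by the last `m`. -/
structure CycleState (n k m : ℕ) where
  V : Matrix (Fin n) (Fin k ⊕ Fin m) ℂ
  S : Matrix (Fin k ⊕ Fin m) (Fin k ⊕ Fin m) ℂ
  v : Fin k ⊕ Fin m → ℂ
  bt : Fin k ⊕ Fin m → ℂ
  y : Fin n → ℂ

/-- The block `Q₁ = [q_0, …, q_{k+m-1}]`. -/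
def firstBlock {n : ℕ} (k m : ℕ) (q : ℕ → Fin n → ℂ) : Matrix (Fin n) (Fin k ⊕ Fin m) ℂ :=
  Matrix.of fun r => Sum.elim (fun a : Fin k => q a r) (fun c : Fin m => q (k + c) r)

/-- For `i ≥ 1`, the block `Q_{i+1} = [q_{k+im}, …, q_{k+(i+1)m-1}]`. -/
def block {n : ℕ} (k m : ℕ) (q : ℕ → Fin n → ℂ) (i : ℕ) : Matrix (Fin n) (Fin m) ℂ :=
  Matrix.of fun r c => q (k + i * m + c) r

/-- First cycle: `V₁ = Q₁`, `S₁ = T₁ = Q₁ᴴ A Q₁`, `v₁ = e₁ ‖b‖`, `b̃₁ = b₁`, `y₁ = Q₁ f(T₁) e₁ ‖b‖`.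
Here `b₁ = Q₁ᴴ A q_{k+m}` is the coupling column of the projected matrix next to `T₁`. -/
def firstCycle {n : ℕ} (k m : ℕ) (A : Matrix (Fin n) (Fin n) ℂ) (b : Fin n → ℂ) (f : RatFunc ℂ)
    (q : ℕ → Fin n → ℂ) : CycleState n k m :=
  let Q := firstBlock k m q
  let T := Qᴴ * A * Q
  let v : Fin k ⊕ Fin m → ℂ :=
    Sum.elim (fun a => if (a : ℕ) = 0 then (norm2 b : ℂ) else 0) 0
  { V := Q
    S := T
    v := v
    bt := Qᴴ *ᵥ (A *ᵥ q (k + m))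
    y := Q *ᵥ (ratFun f T *ᵥ v) }

/-- The step from cycle `i` to cycle `i + 1` (`i ≥ 1`), given the data `st` of cycle `i` and the
basis `U` of the inner rational Krylov space:
`w = - V U f(Uᴴ S U) Uᴴ v`, `V' = [V U, Q]`, `v' = [Uᴴ v; 0]`,
`S' = [Uᴴ S U, Uᴴ b̃ e₁ᴴ; e₁ b̃ᴴ U, T]`, `y' = y + w + V' f(S') v'`, `b̃' = [0; b']`, where
`Q = Q_{i+1}`, `T = Qᴴ A Q`, and `b' = Qᴴ A q_{k+(i+1)m}` is the coupling column next to `T`. -/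
def nextCycle {n k m : ℕ} (A : Matrix (Fin n) (Fin n) ℂ) (f : RatFunc ℂ)
    (q : ℕ → Fin n → ℂ) (i : ℕ) (U : Matrix (Fin k ⊕ Fin m) (Fin k) ℂ)
    (st : CycleState n k m) : CycleState n k m :=
  let Q := block k m q i
  let T := Qᴴ * A * Q
  let e : Fin m → ℂ := fun c => if (c : ℕ) = 0 then 1 else 0
  let B : Matrix (Fin k) (Fin m) ℂ := vecMulVec (Uᴴ *ᵥ st.bt) e
  let w := -((st.V * U) *ᵥ (ratFun f (Uᴴ * st.S * U) *ᵥ (Uᴴ *ᵥ st.v)))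
  let V' := fromCols (st.V * U) Q
  let v' := Sum.elim (Uᴴ *ᵥ st.v) (0 : Fin m → ℂ)
  let S' := fromBlocks (Uᴴ * st.S * U) B Bᴴ T
  { V := V'
    S := S'
    v := v'
    bt := Sum.elim (0 : Fin k → ℂ) (Qᴴ *ᵥ (A *ᵥ q (k + (i + 1) * m)))
    y := st.y + w + V' *ᵥ (ratFun f S' *ᵥ v') }

/-- The data after cycle `i` of the compressed algorithm, `i = 1, 2, …`, where `U i` is the basis
used to compress after cycle `i` (the value at `i = 0` is a copy of the first cycle, unused). -/
def cycle {n k m : ℕ} (A : Matrix (Fin n) (Fin n) ℂ) (b : Fin n → ℂ) (f : RatFunc ℂ)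
    (q : ℕ → Fin n → ℂ) (U : ℕ → Matrix (Fin k ⊕ Fin m) (Fin k) ℂ) : ℕ → CycleState n k m
  | 0 => firstCycle k m A b f q
  | 1 => firstCycle k m A b f q
  | i + 2 => nextCycle A f q (i + 1) (U (i + 1)) (cycle A b f q U (i + 1))

end RKCompress

end

/-! Fix the cycle at which the iterate is wanted. Border the current matrix `S` by the whole
uncompressed projection `T` onto the basis vectors still to come, giving `G = [S, b̃ eᴴ; e b̃ᴴ, T]`.
For the first cycle, `G` is the Lanczos projection itself: a pole at infinity makes every coupling
vanish except the one with the next basis vector (`IsRationalLanczosBasis.dotProduct_eq_zero`).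

The heart is `ratFun_bordered_compress`: the update `f(G)[v; 0] - [f(S)v; 0]` equals `diag(U, I)`
applied to the same update for the compressed matrices `R = Uᴴ S U` and `G' = [R, Uᴴb̃ eᴴ; e b̃ᴴU,
T]`. To see this, write `f = p/q` and pair polynomials by `Φ(x, y) = x(G) q(G)⁻¹ [y(S) q(S)⁻¹ v; 0]`
minus its lifted compressed analogue. Moving one factor `X` from `x` to `y` changes the first term
by `(b̃ᴴ S^c q(S)⁻¹ v) · G^a q(G)⁻¹ [0; e]`. Both factors are reproduced exactly by the compression:
the vector by `bordered_rational_compress`, the scalar by `dotProduct_rational_compress`, which uses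
conjugation-closed poles. So `Φ` is symmetric in the relevant degrees (`bilin_symm_of_shift`), and
`Φ(p, q) = Φ(q, p)` is the claim.

Up to reindexing, `G'` is the bordered matrix of the next cycle, so induction on the number of
remaining cycles (`cycle_add_y`) telescopes the updates. -/

namespace RKCompress

/-! ### Polynomials in the poles and rational matrix functions. -/

section Functions

theorem mulVec_submatrix_comp {ι κ μ : Type*} [Fintype ι] [Fintype κ] (e : κ ≃ ι)
    (V : Matrix μ ι ℂ) (v : ι → ℂ) : V.submatrix id e *ᵥ (v ∘ e) = V *ᵥ v := by
  rw [Matrix.submatrix_mulVec_equiv]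
  simp [Function.comp_assoc]
variable {ι : Type*} [Fintype ι] [DecidableEq ι]

theorem isUnit_aeval_poleProd {l : ℕ} {ξ : Fin l → OnePoint ℂ} {A : Matrix ι ι ℂ}
    (h : PolesAvoid ξ A) : IsUnit (aeval A (poleProd ξ)) := by
  have hfac : ∀ j, IsUnit (aeval A (poleFactor (ξ j))) := by
    intro j
    cases hz : ξ j using OnePoint.rec with
    | infty => simp [poleFactor]
    | coe z =>
      have h1 := h j z hz
      rw [spectrum.notMem_iff] at h1
      have h2 : aeval A (poleFactor (z : OnePoint ℂ)) = -(algebraMap ℂ (Matrix ι ι ℂ) z - A) := by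
        simp [poleFactor]
      rw [h2]
      exact h1.neg
  have hprod : ∀ s : Finset (Fin l), IsUnit (aeval A (∏ j ∈ s, poleFactor (ξ j))) := by
    intro s
    induction s using Finset.induction_on with
    | empty => simp
    | insert a s ha ih =>
      rw [Finset.prod_insert ha, map_mul]
      exact (hfac a).mul ih
  exact hprod Finset.univ

theorem poleProd_ne_zero {l : ℕ} (ξ : Fin l → OnePoint ℂ) : poleProd ξ ≠ 0 := by
  refine Finset.prod_ne_zero_iff.mpr fun j _ => ?_
  cases ξ j using OnePoint.rec with
  | infty => simp [poleFactor]
  | coe z => exact X_sub_C_ne_zero z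

theorem natDegree_poleFactor_le (z : OnePoint ℂ) : (poleFactor z).natDegree ≤ 1 := by
  cases z using OnePoint.rec with
  | infty => simp [poleFactor]
  | coe z => simp [poleFactor]

theorem prod_poleFactor_mem_degreeLT {l N : ℕ} (ξ : Fin l → OnePoint ℂ) (s : Finset (Fin l))
    (hs : s.card < N) : ∏ j ∈ s, poleFactor (ξ j) ∈ degreeLT ℂ N := by
  rw [mem_degreeLT]
  refine degree_le_natDegree.trans_lt ?_
  have h1 : (∏ j ∈ s, poleFactor (ξ j)).natDegree ≤ s.card := by
    refine (natDegree_prod_le _ _).trans ?_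
    simpa using Finset.sum_le_card_nsmul s _ 1 fun j _ => natDegree_poleFactor_le (ξ j)
  exact_mod_cast h1.trans_lt hs

theorem poleProd_mem_degreeLT {l : ℕ} (ξ : Fin l → OnePoint ℂ) :
    poleProd ξ ∈ degreeLT ℂ (l + 1) :=
  prod_poleFactor_mem_degreeLT ξ _ (by simp)

theorem poleProd_map_conj {l : ℕ} {ξ : Fin l → OnePoint ℂ} (h : ConjClosed ξ) :
    (poleProd ξ).map (starRingEnd ℂ) = poleProd ξ := by
  obtain ⟨σ, hσ⟩ := h
  have hfac : ∀ z : OnePoint ℂ,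
      (poleFactor z).map (starRingEnd ℂ) = poleFactor (z.map (starRingEnd ℂ)) := by
    intro z
    cases z using OnePoint.rec with
    | infty => simp [poleFactor]
    | coe z => simp [poleFactor]
  rw [poleProd, Polynomial.map_prod, ← Equiv.prod_comp σ fun j => poleFactor (ξ j)]
  exact Finset.prod_congr rfl fun j _ => by rw [hfac, hσ]

theorem conjTranspose_aeval {S : Matrix ι ι ℂ} (hS : S.IsHermitian) (p : ℂ[X]) :
    (aeval S p)ᴴ = aeval S (p.map (starRingEnd ℂ)) := by
  induction p using Polynomial.induction_on' with
  | add p q hp hq => simp [hp, hq]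
  | monomial n a =>
    simp [aeval_monomial, conjTranspose_pow, hS.eq, Algebra.algebraMap_eq_smul_one]

/-- The fraction `p / poleProd ξ` need not be reduced. The common factor cancels because its value
at `A` divides an invertible matrix. -/
theorem ratFun_eq {k : ℕ} {f : RatFunc ℂ} {ξ : Fin k → OnePoint ℂ} {p : ℂ[X]}
    (hf : f = algebraMap ℂ[X] (RatFunc ℂ) p / algebraMap ℂ[X] (RatFunc ℂ) (poleProd ξ))
    {A : Matrix ι ι ℂ} (h : PolesAvoid ξ A) :
    ratFun f A = aeval A p * (aeval A (poleProd ξ))⁻¹ := by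
  have hq := poleProd_ne_zero ξ
  obtain ⟨g, hg⟩ : f.denom ∣ poleProd ξ := hf ▸ RatFunc.denom_div_dvd p (poleProd ξ)
  have hp : p = f.num * g := by
    have h1 := RatFunc.num_mul_eq_mul_denom_iff (x := f) (p := p) hq
    have h2 := h1.mpr hf
    rw [hg] at h2
    refine mul_right_cancel₀ f.denom_ne_zero ?_
    rw [← h2]; ring
  have hu := isUnit_aeval_poleProd h
  rw [hg, map_mul] at hu
  have hc : Commute (aeval A f.denom) (aeval A g) := by
    rw [commute_iff_eq, ← map_mul, ← map_mul, mul_comm]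
  have hu2 := (hc.isUnit_mul_iff.mp hu).2
  rw [Matrix.isUnit_iff_isUnit_det] at hu2
  rw [ratFun, hg, hp, map_mul, map_mul,
    Matrix.mul_inv_rev, Matrix.mul_assoc, Matrix.mul_nonsing_inv_cancel_left _ _ hu2]

theorem aeval_submatrix {κ : Type*} [Fintype κ] [DecidableEq κ] (e : κ ≃ ι) (A : Matrix ι ι ℂ)
    (p : ℂ[X]) : aeval (A.submatrix e e) p = (aeval A p).submatrix e e := by
  have := aeval_algHom_apply (Matrix.reindexAlgEquiv ℂ ℂ e.symm).toAlgHom A p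
  simpa using this

theorem ratFun_submatrix {κ : Type*} [Fintype κ] [DecidableEq κ] (e : κ ≃ ι) (f : RatFunc ℂ)
    (A : Matrix ι ι ℂ) : ratFun f (A.submatrix e e) = (ratFun f A).submatrix e e := by
  simp [ratFun, aeval_submatrix, Matrix.inv_submatrix_equiv, Matrix.submatrix_mul_equiv]

theorem ratFun_submatrix_mulVec {κ : Type*} [Fintype κ] [DecidableEq κ] (e : κ ≃ ι)
    (f : RatFunc ℂ) (A : Matrix ι ι ℂ) (v : ι → ℂ) :
    ratFun f (A.submatrix e e) *ᵥ (v ∘ e) = (ratFun f A *ᵥ v) ∘ e := by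
  rw [ratFun_submatrix, Matrix.submatrix_mulVec_equiv]
  simp [Function.comp_assoc]

theorem PolesAvoid.submatrix {κ : Type*} [Fintype κ] [DecidableEq κ] {l : ℕ}
    {ξ : Fin l → OnePoint ℂ} {A : Matrix ι ι ℂ} (h : PolesAvoid ξ A) (e : κ ≃ ι) :
    PolesAvoid ξ (A.submatrix e e) := by
  intro j z hz
  have := AlgEquiv.spectrum_eq (Matrix.reindexAlgEquiv ℂ ℂ e.symm) A
  simp only [Matrix.coe_reindexAlgEquiv, Matrix.reindex_apply, Equiv.symm_symm] at this
  rw [this]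
  exact h j z hz

theorem commute_aeval_inv (A : Matrix ι ι ℂ) (p q : ℂ[X]) :
    aeval A p * (aeval A q)⁻¹ = (aeval A q)⁻¹ * aeval A p := by
  have hc : Commute (aeval A p) (aeval A q) := by
    rw [commute_iff_eq, ← map_mul, ← map_mul, mul_comm]
  by_cases h : IsUnit (aeval A q).det
  · calc aeval A p * (aeval A q)⁻¹
        = (aeval A q)⁻¹ * (aeval A q * aeval A p) * (aeval A q)⁻¹ := by
          rw [Matrix.nonsing_inv_mul_cancel_left _ _ h]
      _ = _ := by
          rw [← hc.eq, ← Matrix.mul_assoc, Matrix.mul_nonsing_inv_cancel_right _ _ h]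
  · simp [Matrix.nonsing_inv_apply_not_isUnit _ h]

end Functions

/-! ### Exactness of compression on Krylov-type subspaces. -/

section Compression

variable {μ ν : Type*} [Fintype μ] [DecidableEq μ] [Fintype ν] [DecidableEq ν]

/-- `U Uᴴ` fixes every `G^j c` with `j < N`, so it can be inserted before each further factor `G`.
The projected identity therefore reaches one degree higher than the unprojected one; that extra
degree accommodates a denominator of degree `N`. -/
theorem aeval_compress {N : ℕ} {G : Matrix μ μ ℂ} {U : Matrix μ ν ℂ} (hU : Uᴴ * U = 1)
    {c : μ → ℂ} (hc : ∀ r ∈ degreeLT ℂ N, ∃ d, aeval G r *ᵥ c = U *ᵥ d) :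
    (∀ r ∈ degreeLT ℂ N, aeval G r *ᵥ c = U *ᵥ (aeval (Uᴴ * G * U) r *ᵥ (Uᴴ *ᵥ c))) ∧
    ∀ r ∈ degreeLT ℂ (N + 1),
      Uᴴ *ᵥ (aeval G r *ᵥ c) = aeval (Uᴴ * G * U) r *ᵥ (Uᴴ *ᵥ c) := by
  have hproj : ∀ r ∈ degreeLT ℂ N, aeval G r *ᵥ c = U *ᵥ (Uᴴ *ᵥ (aeval G r *ᵥ c)) := by
    intro r hr
    obtain ⟨d, hd⟩ := hc r hr
    rw [hd, Matrix.mulVec_mulVec (M := Uᴴ), hU, Matrix.one_mulVec]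
  have hpow : ∀ j ≤ N, Uᴴ *ᵥ (G ^ j *ᵥ c) = (Uᴴ * G * U) ^ j *ᵥ (Uᴴ *ᵥ c) := by
    intro j
    induction j with
    | zero => simp
    | succ j ih =>
      intro hj
      -- Passing to the power `j + 1` only needs the vector of power `j` to lie in the range of `U`.
      have h1 := hproj (X ^ j) (by
        rw [mem_degreeLT, degree_X_pow]; exact_mod_cast hj)
      simp only [map_pow, aeval_X] at h1
      rw [pow_succ', ← Matrix.mulVec_mulVec, h1, ih (by omega), pow_succ']
      simp only [Matrix.mulVec_mulVec, Matrix.mul_assoc]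
  have h2 : ∀ r ∈ degreeLT ℂ (N + 1),
      Uᴴ *ᵥ (aeval G r *ᵥ c) = aeval (Uᴴ * G * U) r *ᵥ (Uᴴ *ᵥ c) := by
    intro r hr
    rw [mem_degreeLT] at hr
    have hn : r.natDegree < N + 1 := by
      by_cases h0 : r = 0
      · simp [h0]
      · exact (natDegree_lt_iff_degree_lt h0).mpr hr
    simp only [aeval_eq_sum_range' hn, Matrix.sum_mulVec, Matrix.smul_mulVec, Matrix.mulVec_sum,
      Matrix.mulVec_smul]
    refine Finset.sum_congr rfl fun j hj => ?_
    rw [hpow j (by simpa [Nat.lt_succ_iff] using hj)]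
  refine ⟨fun r hr => ?_, h2⟩
  rw [← h2 r (degreeLT_mono (Nat.le_succ N) hr)]
  exact hproj r hr

/-- Apply polynomial exactness to the starting vector `q(G)⁻¹ g`. Its top-degree case at `q`
identifies `Uᴴ q(G)⁻¹ g` with the compressed resolvent applied to `Uᴴ g`. -/
theorem rational_compress {N : ℕ} {G : Matrix μ μ ℂ} {U : Matrix μ ν ℂ} (hU : Uᴴ * U = 1)
    {q : ℂ[X]} (hq : q ∈ degreeLT ℂ (N + 1)) (hG : IsUnit (aeval G q))
    (hG' : IsUnit (aeval (Uᴴ * G * U) q)) {g : μ → ℂ}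
    (hc : ∀ r ∈ degreeLT ℂ N, ∃ d, aeval G r *ᵥ ((aeval G q)⁻¹ *ᵥ g) = U *ᵥ d) :
    ∀ r ∈ degreeLT ℂ N, aeval G r *ᵥ ((aeval G q)⁻¹ *ᵥ g) =
      U *ᵥ (aeval (Uᴴ * G * U) r *ᵥ ((aeval (Uᴴ * G * U) q)⁻¹ *ᵥ (Uᴴ *ᵥ g))) := by
  rw [Matrix.isUnit_iff_isUnit_det] at hG hG'
  obtain ⟨h1, h2⟩ := aeval_compress hU hc
  have h3 := h2 q hq
  rw [Matrix.mulVec_mulVec (M := aeval G q), Matrix.mul_nonsing_inv _ hG, Matrix.one_mulVec] at h3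
  intro r hr
  rw [h1 r hr, h3, Matrix.mulVec_mulVec _ (aeval (Uᴴ * G * U) q)⁻¹, Matrix.nonsing_inv_mul _ hG',
    Matrix.one_mulVec]

end Compression

/-! ### Bordered matrices with rank-one coupling. -/

section Bordered

/-- The matrix `[S, b eᴴ; e bᴴ, T]`. -/
def bordered {ι κ : Type*} (S : Matrix ι ι ℂ) (b : ι → ℂ) (e : κ → ℂ) (T : Matrix κ κ ℂ) :
    Matrix (ι ⊕ κ) (ι ⊕ κ) ℂ :=
  fromBlocks S (vecMulVec b (star e)) (vecMulVec b (star e))ᴴ T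

theorem bordered_mulVec {ι κ : Type*} [Fintype ι] [Fintype κ]
    (S : Matrix ι ι ℂ) (b : ι → ℂ) (e : κ → ℂ) (T : Matrix κ κ ℂ) (x : ι → ℂ) (y : κ → ℂ) :
    bordered S b e T *ᵥ Sum.elim x y =
      Sum.elim (S *ᵥ x + (star e ⬝ᵥ y) • b) ((star b ⬝ᵥ x) • e + T *ᵥ y) := by
  rw [bordered, fromBlocks_mulVec]
  congr 1
  · simp [Matrix.vecMulVec_mulVec]
  · simp [Matrix.conjTranspose_vecMulVec, Matrix.vecMulVec_mulVec]

/-- Each multiplication by the bordered matrix applies `S` to the top part and adds a multiple of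
`b`. The accumulated contribution of `b` is thus a polynomial in `S` of degree one lower. -/
theorem aeval_bordered_top {ι κ : Type*} [Fintype ι] [DecidableEq ι] [Fintype κ] [DecidableEq κ]
    (S : Matrix ι ι ℂ) (b : ι → ℂ) (e : κ → ℂ) (T : Matrix κ κ ℂ)
    (w : ι ⊕ κ → ℂ) {N : ℕ} (r : ℂ[X]) (hr : r ∈ degreeLT ℂ (N + 1)) :
    ∃ p ∈ degreeLT ℂ N,
      (aeval (bordered S b e T) r *ᵥ w) ∘ Sum.inl = aeval S r *ᵥ (w ∘ Sum.inl) + aeval S p *ᵥ b := by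
  have hpow : ∀ j ≤ N, ∃ p ∈ degreeLT ℂ j,
      ((bordered S b e T) ^ j *ᵥ w) ∘ Sum.inl = S ^ j *ᵥ (w ∘ Sum.inl) + aeval S p *ᵥ b := by
    intro j
    induction j with
    | zero => exact fun _ => ⟨0, Submodule.zero_mem _, by simp⟩
    | succ j ih =>
      intro hj
      obtain ⟨p, hp, h⟩ := ih (by omega)
      set u := (bordered S b e T) ^ j *ᵥ w with hu
      refine ⟨X * p + C (star e ⬝ᵥ (u ∘ Sum.inr)), ?_, ?_⟩
      · refine Submodule.add_mem _ ?_ ?_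
        · rw [mem_degreeLT] at hp ⊢
          by_cases h0 : p = 0
          · simp [h0]
          · rw [degree_eq_natDegree h0] at hp
            rw [degree_mul, degree_X, degree_eq_natDegree h0]
            have : p.natDegree < j := by exact_mod_cast hp
            exact_mod_cast (by omega : 1 + p.natDegree < j + 1)
        · rw [mem_degreeLT]
          exact degree_C_le.trans_lt (by exact_mod_cast Nat.succ_pos j)
      · rw [pow_succ', ← Matrix.mulVec_mulVec, ← hu, ← Sum.elim_comp_inl_inr u, bordered_mulVec,
          Sum.elim_comp_inl, h]
        simp only [Sum.elim_comp_inr, Matrix.mulVec_add, Matrix.mulVec_mulVec, pow_succ', map_add,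
          map_mul, aeval_X, aeval_C, Matrix.add_mulVec, Algebra.algebraMap_eq_smul_one, Matrix.smul_mulVec,
          Matrix.one_mulVec, add_assoc]
  choose! P hP hP2 using hpow
  have hn : r.natDegree < N + 1 := by
    by_cases h0 : r = 0
    · simp [h0]
    · exact (natDegree_lt_iff_degree_lt h0).mpr (mem_degreeLT.mp hr)
  refine ⟨∑ j ∈ Finset.range (N + 1), r.coeff j • P j, ?_, ?_⟩
  · refine Submodule.sum_mem _ fun j hj => Submodule.smul_mem _ _ ?_
    have hj' : j ≤ N := by simpa [Nat.lt_succ_iff] using hj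
    exact degreeLT_mono hj' (hP j hj')
  · simp only [aeval_eq_sum_range' hn, Matrix.sum_mulVec, Matrix.smul_mulVec, map_sum, map_smul]
    rw [← Finset.sum_add_distrib]
    ext x
    simp only [Function.comp_apply, Finset.sum_apply, Pi.smul_apply, Pi.add_apply]
    refine Finset.sum_congr rfl fun j hj => ?_
    have h1 := congrFun (hP2 j (by simpa [Nat.lt_succ_iff] using hj)) x
    simp only [Function.comp_apply, Pi.add_apply] at h1
    rw [h1, smul_add]

end Bordered

/-! ### Symmetry of bilinear maps on polynomials, and auxiliary identities. -/

/-- By repeated shifts `Φ(X^(a+t), X^a) = Φ(X^a, X^(a+t))`, and no exponent exceeds `N` on the way.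
Bilinearity does the rest. -/
theorem bilin_symm_of_shift {V : Type*} [AddCommGroup V] [Module ℂ V] {N : ℕ}
    (Φ : ℂ[X] →ₗ[ℂ] ℂ[X] →ₗ[ℂ] V)
    (hΦ : ∀ a < N, ∀ c < N, Φ (X ^ (a + 1)) (X ^ c) = Φ (X ^ a) (X ^ (c + 1)))
    {p r : ℂ[X]} (hp : p ∈ degreeLT ℂ (N + 1)) (hr : r ∈ degreeLT ℂ (N + 1)) :
    Φ p r = Φ r p := by
  have hshift : ∀ t a c, a + t ≤ N → c + t ≤ N →
      Φ (X ^ (a + t)) (X ^ c) = Φ (X ^ a) (X ^ (c + t)) := by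
    intro t
    induction t with
    | zero => intros; rfl
    | succ t ih =>
      intro a c ha hc
      rw [← add_assoc, hΦ _ (by omega) _ (by omega), ih a (c + 1) (by omega) (by omega)]
      congr 2
      omega
  have hmono : ∀ a ≤ N, ∀ c ≤ N, Φ (X ^ a) (X ^ c) = Φ (X ^ c) (X ^ a) := by
    intro a ha c hc
    rcases le_total a c with h | h
    · obtain ⟨t, rfl⟩ := Nat.exists_eq_add_of_le h
      exact (hshift t a a hc hc).symm
    · obtain ⟨t, rfl⟩ := Nat.exists_eq_add_of_le h
      exact hshift t c c ha ha
  have hspan : ∀ x ∈ degreeLT ℂ (N + 1),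
      x ∈ Submodule.span ℂ ((fun n : ℕ => (X : ℂ[X]) ^ n) '' Set.Iio (N + 1)) := by
    intro x hx
    rw [degreeLT_eq_span_X_pow] at hx
    refine Submodule.span_mono ?_ hx
    intro y hy
    simpa using hy
  refine Submodule.span_induction₂ (p := fun x y _ _ => Φ x y = Φ y x) ?_ ?_ ?_ ?_ ?_ ?_ ?_
    (hspan p hp) (hspan r hr)
  · rintro _ _ ⟨a, ha, rfl⟩ ⟨c, hc, rfl⟩
    exact hmono a (Nat.lt_succ_iff.mp ha) c (Nat.lt_succ_iff.mp hc)
  · intros; simp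
  · intros; simp
  · intro x y z _ _ _ h1 h2; simp [h1, h2]
  · intro x y z _ _ _ h1 h2; simp [h1, h2]
  · intro c x y _ _ h; simp [h]
  · intro c x y _ _ h; simp [h]

theorem notMem_spectrum_iff {ι : Type*} [Fintype ι] [DecidableEq ι] {A : Matrix ι ι ℂ} {z : ℂ} :
    z ∉ spectrum ℂ A ↔ ∀ x, A *ᵥ x = z • x → x = 0 := by
  rw [spectrum.notMem_iff, ← Matrix.mulVec_injective_iff_isUnit, ← Matrix.coe_mulVecLin,
    ← LinearMap.ker_eq_bot, LinearMap.ker_eq_bot']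
  refine forall_congr' fun x => ?_
  have : (algebraMap ℂ (Matrix ι ι ℂ) z - A) *ᵥ x = z • x - A *ᵥ x := by
    simp [Matrix.sub_mulVec, Algebra.algebraMap_eq_smul_one, Matrix.smul_mulVec]
  rw [Matrix.mulVecLin_apply, this, sub_eq_zero, eq_comm]

theorem sum_elim_zero_eq {α κ : Type*} [Fintype α] [DecidableEq α] (x : α → ℂ) :
    Sum.elim x (0 : κ → ℂ) = fromRows (1 : Matrix α α ℂ) (0 : Matrix κ α ℂ) *ᵥ x := by
  simp [fromRows_mulVec]

theorem smul_sum_elim {α κ : Type*} (z : ℂ) (u : α → ℂ) (w : κ → ℂ) :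
    z • Sum.elim u w = Sum.elim (z • u) (z • w) := by
  ext i
  cases i <;> rfl

theorem sum_elim_smul_right {α κ : Type*} (x : α → ℂ) (t : ℂ) (e : κ → ℂ) :
    Sum.elim x (t • e) = Sum.elim x (0 : κ → ℂ) + t • Sum.elim (0 : α → ℂ) e := by
  ext i
  cases i <;> simp

theorem aeval_X_pow_succ_inv_mulVec {α : Type*} [Fintype α] [DecidableEq α] (H : Matrix α α ℂ)
    (Q : ℂ[X]) (a : ℕ) (x : α → ℂ) :
    aeval H (X ^ (a + 1) : ℂ[X]) *ᵥ ((aeval H Q)⁻¹ *ᵥ x) =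
      aeval H (X ^ a : ℂ[X]) *ᵥ ((aeval H Q)⁻¹ *ᵥ (H *ᵥ x)) := by
  have h1 := commute_aeval_inv H X Q
  rw [aeval_X] at h1
  rw [pow_succ, map_mul, aeval_X, Matrix.mulVec_mulVec, Matrix.mul_assoc, h1,
    Matrix.mulVec_mulVec, Matrix.mulVec_mulVec, Matrix.mul_assoc]

/-- Conjugation-closed poles give the denominator real coefficients, so at a Hermitian matrix its
value is Hermitian and can be moved across the inner product. -/
theorem dotProduct_pow_inv_mulVec {α : Type*} [Fintype α] [DecidableEq α] {k : ℕ}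
    {ξ : Fin k → OnePoint ℂ} (hξ : ConjClosed ξ) {R : Matrix α α ℂ} (hR : R.IsHermitian)
    (c : ℕ) (x y : α → ℂ) :
    star x ⬝ᵥ (R ^ c *ᵥ ((aeval R (poleProd ξ))⁻¹ *ᵥ y)) =
      star (aeval R (X ^ c : ℂ[X]) *ᵥ ((aeval R (poleProd ξ))⁻¹ *ᵥ x)) ⬝ᵥ y := by
  have h1 : ((aeval R (poleProd ξ))⁻¹)ᴴ = (aeval R (poleProd ξ))⁻¹ := by
    rw [conjTranspose_nonsing_inv, conjTranspose_aeval hR, poleProd_map_conj hξ]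
  rw [Matrix.mulVec_mulVec, Matrix.mulVec_mulVec, commute_aeval_inv, star_mulVec,
    ← Matrix.dotProduct_mulVec, conjTranspose_mul, h1, conjTranspose_aeval hR]
  simp

/-- The block diagonal matrix `diag(U, I)`. -/
def extendOne {ι μ : Type*} (κ : Type*) [DecidableEq κ] (U : Matrix ι μ ℂ) :
    Matrix (ι ⊕ κ) (μ ⊕ κ) ℂ :=
  fromBlocks U 0 0 1

theorem extendOne_mulVec {ι κ μ : Type*} [Fintype κ] [DecidableEq κ] [Fintype μ]
    (U : Matrix ι μ ℂ) (x : μ → ℂ) (y : κ → ℂ) :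
    extendOne κ U *ᵥ Sum.elim x y = Sum.elim (U *ᵥ x) y := by
  simp [extendOne, fromBlocks_mulVec]

theorem extendOne_conjTranspose {ι κ μ : Type*} [DecidableEq κ] (U : Matrix ι μ ℂ) :
    (extendOne κ U)ᴴ = extendOne κ Uᴴ := by
  simp [extendOne, fromBlocks_conjTranspose]

/-! ### Compression of the bordered matrix through the inner rational Krylov space. -/

section

variable {ι κ μ : Type*} [Fintype ι] [DecidableEq ι] [Fintype κ] [DecidableEq κ]
  [Fintype μ] [DecidableEq μ]

theorem extendOne_isometry {ι κ μ : Type*} [Fintype ι] [Fintype κ] [DecidableEq κ]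
    [DecidableEq μ] {U : Matrix ι μ ℂ} (hU : Uᴴ * U = 1) :
    (extendOne κ U)ᴴ * extendOne κ U = 1 := by
  rw [extendOne_conjTranspose]
  simp [extendOne, fromBlocks_multiply, hU]

theorem bordered_compress {ι κ μ : Type*} [Fintype ι] [Fintype κ] [DecidableEq κ]
    (S : Matrix ι ι ℂ) (b : ι → ℂ) (e : κ → ℂ) (T : Matrix κ κ ℂ)
    (U : Matrix ι μ ℂ) :
    (extendOne κ U)ᴴ * bordered S b e T * extendOne κ U =
      bordered (Uᴴ * S * U) (Uᴴ *ᵥ b) e T := by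
  rw [extendOne_conjTranspose]
  simp [extendOne, bordered, fromBlocks_multiply, conjTranspose_vecMulVec, mul_vecMulVec,
    vecMulVec_mul, star_mulVec]

theorem ratKrylov_range {k : ℕ} {ξ : Fin k → OnePoint ℂ} {S : Matrix ι ι ℂ} {b : ι → ℂ}
    {U : Matrix ι μ ℂ} (hU : IsOrthonormalBasisOf U (ratKrylov S b ξ)) {p : ℂ[X]}
    (hp : p ∈ degreeLT ℂ k) :
    ∃ d, (aeval S (poleProd ξ))⁻¹ *ᵥ (aeval S p *ᵥ b) = U *ᵥ d := by
  have h : (aeval S (poleProd ξ))⁻¹ *ᵥ (aeval S p *ᵥ b) ∈ ratKrylov S b ξ := ⟨p, hp, rfl⟩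
  rw [← hU.2] at h
  obtain ⟨d, hd⟩ := h
  exact ⟨d, hd.symm⟩

/-- The partly compressed bordered matrices met in the induction are not covered by the assumptions
of the theorem; this lemma supplies their pole condition. An eigenvector of the compressed matrix at
a pole `z` has top part proportional to the coordinates of `(S - z)⁻¹ b`, a vector of the Krylov
space, so it lifts to an eigenvector of the larger matrix. -/
theorem polesAvoid_bordered_compress {k : ℕ} {ξ : Fin k → OnePoint ℂ} {S : Matrix ι ι ℂ}
    {b : ι → ℂ} {e : κ → ℂ} {T : Matrix κ κ ℂ} {U : Matrix ι μ ℂ}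
    (hU : IsOrthonormalBasisOf U (ratKrylov S b ξ)) (hS : PolesAvoid ξ S)
    (hSU : PolesAvoid ξ (Uᴴ * S * U)) (hG : PolesAvoid ξ (bordered S b e T)) :
    PolesAvoid ξ (bordered (Uᴴ * S * U) (Uᴴ *ᵥ b) e T) := by
  intro j z hz
  have hSU' := notMem_spectrum_iff.mp (hSU j z hz)
  have hG' := notMem_spectrum_iff.mp (hG j z hz)
  rw [notMem_spectrum_iff]
  intro x hx
  -- Dropping the factor of the pole `z` from the denominator polynomial leaves a numerator of
  -- degree below `k`; hence `U c0 = (S - z)⁻¹ b`.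
  obtain ⟨c0, hc0⟩ := ratKrylov_range hU (p := ∏ i ∈ Finset.univ.erase j, poleFactor (ξ i))
    (prod_poleFactor_mem_degreeLT ξ _ (by
      rw [Finset.card_erase_of_mem (Finset.mem_univ j)]
      simpa using j.pos))
  have hfac : poleProd ξ = (X - C z) * ∏ i ∈ Finset.univ.erase j, poleFactor (ξ i) := by
    rw [poleProd, ← Finset.mul_prod_erase Finset.univ _ (Finset.mem_univ j), hz]
    rfl
  have hres : S *ᵥ (U *ᵥ c0) = z • (U *ᵥ c0) + b := by
    have hu := isUnit_aeval_poleProd hS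
    rw [Matrix.isUnit_iff_isUnit_det] at hu
    have h1 : aeval S (X - C z) *ᵥ (U *ᵥ c0) = b := by
      rw [← hc0, Matrix.mulVec_mulVec, Matrix.mulVec_mulVec, commute_aeval_inv, Matrix.mul_assoc,
        ← map_mul, ← hfac, Matrix.nonsing_inv_mul _ hu, Matrix.one_mulVec]
    rw [map_sub, aeval_X, aeval_C, Matrix.sub_mulVec, sub_eq_iff_eq_add] at h1
    rw [h1, Algebra.algebraMap_eq_smul_one, Matrix.smul_mulVec, Matrix.one_mulVec, add_comm]
  have hres' : (Uᴴ * S * U) *ᵥ c0 = z • c0 + Uᴴ *ᵥ b := by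
    have h1 := congrArg (Uᴴ *ᵥ ·) hres
    simpa [Matrix.mulVec_add, Matrix.mulVec_smul, Matrix.mulVec_mulVec, hU.1,
      Matrix.mul_assoc] using h1
  obtain ⟨c, d, rfl⟩ : ∃ c d, x = Sum.elim c d := ⟨_, _, (Sum.elim_comp_inl_inr x).symm⟩
  rw [bordered_mulVec, smul_sum_elim, Sum.elim_eq_iff] at hx
  obtain ⟨hx1, hx2⟩ := hx
  -- The sum `c + (eᴴ d) c0` satisfies the eigenvalue equation of `Uᴴ S U` at `z`, which has no
  -- nonzero solution.
  have hc : c = -((star e ⬝ᵥ d) • c0) := by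
    rw [← add_eq_zero_iff_eq_neg]
    refine hSU' _ ?_
    rw [Matrix.mulVec_add, Matrix.mulVec_smul, hres', smul_add, smul_add, ← hx1]
    module
  have h0 := hG' (Sum.elim (U *ᵥ c) d) (by
    rw [bordered_mulVec, smul_sum_elim, Sum.elim_eq_iff]
    constructor
    · rw [hc]
      simp only [Matrix.mulVec_neg, Matrix.mulVec_smul, hres]
      module
    · rw [← hx2, star_mulVec, conjTranspose_conjTranspose, ← Matrix.dotProduct_mulVec])
  have h1 : (0 : ι ⊕ κ → ℂ) = Sum.elim (0 : ι → ℂ) (0 : κ → ℂ) := by simp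
  rw [h1, Sum.elim_eq_iff] at h0
  have h2 : c = 0 := by
    have := congrArg (Uᴴ *ᵥ ·) h0.1
    simpa [Matrix.mulVec_mulVec, hU.1] using this
  rw [h2, h0.2]
  simp

/-- Let `u = r(G) q(G)⁻¹ [0; e]`. Comparing the top parts of `q(G) u = r(G) [0; e]` puts the top
part of `u` in the Krylov space, so `u` lies in the range of `diag(U, I)` and `rational_compress`
applies. -/
theorem bordered_rational_compress {k : ℕ} {ξ : Fin k → OnePoint ℂ} {S : Matrix ι ι ℂ}
    {b : ι → ℂ} {e : κ → ℂ} {T : Matrix κ κ ℂ} {U : Matrix ι μ ℂ}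
    (hU : IsOrthonormalBasisOf U (ratKrylov S b ξ)) (hS : PolesAvoid ξ S)
    (hG : PolesAvoid ξ (bordered S b e T))
    (hG' : PolesAvoid ξ (bordered (Uᴴ * S * U) (Uᴴ *ᵥ b) e T)) {r : ℂ[X]}
    (hr : r ∈ degreeLT ℂ k) :
    aeval (bordered S b e T) r *ᵥ
        ((aeval (bordered S b e T) (poleProd ξ))⁻¹ *ᵥ Sum.elim (0 : ι → ℂ) e) =
      extendOne κ U *ᵥ (aeval (bordered (Uᴴ * S * U) (Uᴴ *ᵥ b) e T) r *ᵥ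
        ((aeval (bordered (Uᴴ * S * U) (Uᴴ *ᵥ b) e T) (poleProd ξ))⁻¹ *ᵥ
          Sum.elim (0 : μ → ℂ) e)) := by
  have hS1 := isUnit_aeval_poleProd hS
  have hG1 := isUnit_aeval_poleProd hG
  have hG2 := isUnit_aeval_poleProd hG'
  have hU1 := extendOne_isometry (κ := κ) hU.1
  have hê : (extendOne κ U)ᴴ *ᵥ Sum.elim (0 : ι → ℂ) e = Sum.elim (0 : μ → ℂ) e := by
    rw [extendOne_conjTranspose, extendOne_mulVec, Matrix.mulVec_zero]
  rw [← bordered_compress] at hG2 ⊢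
  rw [← hê]
  refine rational_compress hU1 (poleProd_mem_degreeLT ξ) hG1 hG2 ?_ r hr
  intro r hr
  rw [Matrix.isUnit_iff_isUnit_det] at hS1 hG1
  set G := bordered S b e T with hGdef
  set u := aeval G r *ᵥ ((aeval G (poleProd ξ))⁻¹ *ᵥ Sum.elim (0 : ι → ℂ) e) with hu
  have h1 : aeval G (poleProd ξ) *ᵥ u = aeval G r *ᵥ Sum.elim (0 : ι → ℂ) e := by
    rw [hu, Matrix.mulVec_mulVec _ (aeval G r), commute_aeval_inv, Matrix.mulVec_mulVec,
      Matrix.mul_nonsing_inv_cancel_left _ _ hG1]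
  obtain ⟨p1, hp1, ht1⟩ := aeval_bordered_top S b e T u _ (poleProd_mem_degreeLT ξ)
  obtain ⟨p2, hp2, ht2⟩ := aeval_bordered_top S b e T (Sum.elim 0 e) r
    (degreeLT_mono (Nat.le_succ k) hr)
  -- The top parts now read `p2(S) b = q(S) u_top + p1(S) b`, which is solved for `u_top`.
  rw [← hGdef, h1, ht2, Sum.elim_comp_inl, Matrix.mulVec_zero, zero_add] at ht1
  obtain ⟨d, hd⟩ := ratKrylov_range hU (Submodule.sub_mem _ hp2 hp1)
  refine ⟨Sum.elim d (u ∘ Sum.inr), ?_⟩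
  rw [extendOne_mulVec, ← hd, map_sub, Matrix.sub_mulVec, ht1, add_sub_cancel_right,
    Matrix.mulVec_mulVec, Matrix.nonsing_inv_mul _ hS1, Matrix.one_mulVec, Sum.elim_comp_inl_inr]

theorem dotProduct_rational_compress {k : ℕ} {ξ : Fin k → OnePoint ℂ} (hξ : ConjClosed ξ)
    {S : Matrix ι ι ℂ} (hSH : S.IsHermitian) {b : ι → ℂ} {U : Matrix ι μ ℂ}
    (hU : IsOrthonormalBasisOf U (ratKrylov S b ξ)) (hS : PolesAvoid ξ S)
    (hSU : PolesAvoid ξ (Uᴴ * S * U)) (v : ι → ℂ) {c : ℕ} (hc : c < k) :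
    star b ⬝ᵥ (S ^ c *ᵥ ((aeval S (poleProd ξ))⁻¹ *ᵥ v)) =
      star (Uᴴ *ᵥ b) ⬝ᵥ ((Uᴴ * S * U) ^ c *ᵥ
        ((aeval (Uᴴ * S * U) (poleProd ξ))⁻¹ *ᵥ (Uᴴ *ᵥ v))) := by
  have hSUH : (Uᴴ * S * U).IsHermitian := isHermitian_conjTranspose_mul_mul U hSH
  rw [dotProduct_pow_inv_mulVec hξ hSH, dotProduct_pow_inv_mulVec hξ hSUH,
    rational_compress hU.1 (poleProd_mem_degreeLT ξ)
    (isUnit_aeval_poleProd hS) (isUnit_aeval_poleProd hSU) ?_ (X ^ c) ?_]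
  · rw [star_mulVec, ← Matrix.dotProduct_mulVec]
  · intro r hr
    obtain ⟨d, hd⟩ := ratKrylov_range hU hr
    refine ⟨d, ?_⟩
    rw [← hd, Matrix.mulVec_mulVec, Matrix.mulVec_mulVec, commute_aeval_inv]
  · rw [mem_degreeLT, degree_X_pow]
    exact_mod_cast hc

theorem ratFun_bordered_compress {k : ℕ} {ξ : Fin k → OnePoint ℂ} (hξ : ConjClosed ξ)
    {f : RatFunc ℂ} (hf : HasTypeWithPoles f ξ)
    {S : Matrix ι ι ℂ} (hSH : S.IsHermitian) {b : ι → ℂ} {e : κ → ℂ} {T : Matrix κ κ ℂ}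
    {U : Matrix ι μ ℂ} (hU : IsOrthonormalBasisOf U (ratKrylov S b ξ)) (hS : PolesAvoid ξ S)
    (hSU : PolesAvoid ξ (Uᴴ * S * U)) (hG : PolesAvoid ξ (bordered S b e T)) (v : ι → ℂ) :
    ratFun f (bordered S b e T) *ᵥ Sum.elim v (0 : κ → ℂ) =
      Sum.elim (ratFun f S *ᵥ v) (0 : κ → ℂ) + extendOne κ U *ᵥ
        (ratFun f (bordered (Uᴴ * S * U) (Uᴴ *ᵥ b) e T) *ᵥ Sum.elim (Uᴴ *ᵥ v) (0 : κ → ℂ) -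
          Sum.elim (ratFun f (Uᴴ * S * U) *ᵥ (Uᴴ *ᵥ v)) (0 : κ → ℂ)) := by
  have hG' := polesAvoid_bordered_compress hU hS hSU hG
  obtain ⟨p, hp, hfp⟩ := hf
  rw [ratFun_eq hfp hG, ratFun_eq hfp hG', ratFun_eq hfp hS, ratFun_eq hfp hSU]
  have hexact : ∀ a < k, _ := fun a ha => bordered_rational_compress hU hS hG hG'
    (r := X ^ a) (by rw [mem_degreeLT, degree_X_pow]; exact_mod_cast ha)
  have hdot : ∀ c < k, _ := fun c hc => dotProduct_rational_compress hξ hSH hU hS hSU v hc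
  have hb := bordered_mulVec S b e T
  have hb' := bordered_mulVec (Uᴴ * S * U) (Uᴴ *ᵥ b) e T
  have hS1 := (Matrix.isUnit_iff_isUnit_det _).mp (isUnit_aeval_poleProd hS)
  have hSU1 := (Matrix.isUnit_iff_isUnit_det _).mp (isUnit_aeval_poleProd hSU)
  have hG1 := (Matrix.isUnit_iff_isUnit_det _).mp (isUnit_aeval_poleProd hG)
  have hG2 := (Matrix.isUnit_iff_isUnit_det _).mp (isUnit_aeval_poleProd hG')
  set R := Uᴴ * S * U with hR
  set G := bordered S b e T
  set G' := bordered R (Uᴴ *ᵥ b) e T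
  set v' := Uᴴ *ᵥ v
  have hq := poleProd_mem_degreeLT ξ
  set Q := poleProd ξ
  set u := (aeval S Q)⁻¹ *ᵥ v with hu
  set u' := (aeval R Q)⁻¹ *ᵥ v' with hu'
  -- The defect of compression as a pairing: the first polynomial acts after the zero-padding, the
  -- second before it.
  let Φ : ℂ[X] →ₗ[ℂ] ℂ[X] →ₗ[ℂ] (ι ⊕ κ → ℂ) := LinearMap.mk₂ ℂ
    (fun x y => aeval G x *ᵥ ((aeval G Q)⁻¹ *ᵥ Sum.elim (aeval S y *ᵥ u) (0 : κ → ℂ)) -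
      extendOne κ U *ᵥ (aeval G' x *ᵥ ((aeval G' Q)⁻¹ *ᵥ
        Sum.elim (aeval R y *ᵥ u') (0 : κ → ℂ))))
    (by intros; simp only [map_add, Matrix.add_mulVec, Matrix.mulVec_add]; abel)
    (by intros; simp only [map_smul, Matrix.smul_mulVec, Matrix.mulVec_smul, smul_sub])
    (by intros; simp only [sum_elim_zero_eq, map_add, Matrix.add_mulVec, Matrix.mulVec_add]; abel)
    (by
      intros
      simp only [sum_elim_zero_eq, map_smul, Matrix.smul_mulVec, Matrix.mulVec_smul, smul_sub])
  -- At `(p, Q)` the inner inverse cancels and the bordered functions remain; at `(Q, p)` the outer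
  -- inverse cancels and the unbordered ones remain.
  have hsym : Φ p Q = Φ Q p := by
    refine bilin_symm_of_shift Φ ?_ (degreeLT_mono (Nat.le_succ k) hp) hq
    intro a ha c hc
    simp only [Φ, LinearMap.mk₂_apply]
    rw [aeval_X_pow_succ_inv_mulVec, aeval_X_pow_succ_inv_mulVec, hb, hb']
    simp only [Matrix.mulVec_zero, dotProduct_zero, zero_smul, add_zero]
    rw [sum_elim_smul_right, sum_elim_smul_right,
      map_pow, map_pow, map_pow, map_pow, aeval_X, aeval_X, hdot c hc]
    simp only [Matrix.mulVec_add, Matrix.mulVec_smul]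
    have h1 := hexact a ha
    simp only [map_pow, aeval_X] at h1 ⊢
    rw [h1]
    simp only [pow_succ', ← Matrix.mulVec_mulVec]
    abel
  simp only [Φ, LinearMap.mk₂_apply] at hsym
  have hv : aeval S Q *ᵥ u = v := by
    rw [hu, Matrix.mulVec_mulVec, Matrix.mul_nonsing_inv _ hS1, Matrix.one_mulVec]
  have hv' : aeval R Q *ᵥ u' = v' := by
    rw [hu', Matrix.mulVec_mulVec, Matrix.mul_nonsing_inv _ hSU1, Matrix.one_mulVec]
  rw [hv, hv', Matrix.mulVec_mulVec _ (aeval G Q), Matrix.mul_nonsing_inv _ hG1,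
    Matrix.mulVec_mulVec _ (aeval G' Q), Matrix.mul_nonsing_inv _ hG2, Matrix.one_mulVec,
    Matrix.one_mulVec] at hsym
  simp only [← Matrix.mulVec_mulVec]
  rw [Matrix.mulVec_sub, ← hu, ← hu', sub_eq_iff_eq_add.mp hsym]
  abel

end

/-! ### Lanczos couplings and the bordered matrices of the cycles. -/

/-- The matrix with columns `q (g c)`. -/
def cols {n : ℕ} {κ : Type*} (q : ℕ → Fin n → ℂ) (g : κ → ℕ) : Matrix (Fin n) κ ℂ :=
  Matrix.of fun r c => q (g c) r

theorem firstBlock_eq_cols {n : ℕ} (k m : ℕ) (q : ℕ → Fin n → ℂ) :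
    firstBlock k m q = cols q (Sum.elim (fun a : Fin k => (a : ℕ)) fun c : Fin m => k + c) := by
  ext r (a | c) <;> rfl

theorem cols_gram_apply {n : ℕ} {κ κ' : Type*} (A : Matrix (Fin n) (Fin n) ℂ)
    (q : ℕ → Fin n → ℂ) (g : κ → ℕ) (h : κ' → ℕ) (a : κ) (c : κ') :
    ((cols q g)ᴴ * A * cols q h) a c = star (q (g a)) ⬝ᵥ (A *ᵥ q (h c)) := by
  rw [Matrix.mul_assoc]
  rfl

theorem cols_conjTranspose_mulVec_apply {n : ℕ} {κ : Type*} (q : ℕ → Fin n → ℂ) (g : κ → ℕ)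
    (x : Fin n → ℂ) (a : κ) : ((cols q g)ᴴ *ᵥ x) a = star (q (g a)) ⬝ᵥ x :=
  rfl

theorem star_dotProduct_mulVec_symm {n : ℕ} {A : Matrix (Fin n) (Fin n) ℂ} (hA : A.IsHermitian)
    (x y : Fin n → ℂ) : star (star x ⬝ᵥ (A *ᵥ y)) = star y ⬝ᵥ (A *ᵥ x) := by
  rw [← Matrix.star_dotProduct_star, star_star, star_mulVec, hA.eq, ← Matrix.dotProduct_mulVec]

/-- A pole at infinity leaves the denominator unchanged while raising the permitted degree, so `A
q_a` lies in the span of `q_0, …, q_l`, to which `q_x` is orthogonal. -/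
theorem IsRationalLanczosBasis.dotProduct_eq_zero {n M : ℕ} {A : Matrix (Fin n) (Fin n) ℂ}
    (hA : A.IsHermitian) {b : Fin n → ℂ} {θ : ℕ → OnePoint ℂ} {q : ℕ → Fin n → ℂ}
    (hq : IsRationalLanczosBasis A b θ M q) {l a x : ℕ} (hθ : θ l = OnePoint.infty) (ha : a < l)
    (hl : l < x) (hx : x < M) : star (q a) ⬝ᵥ (A *ᵥ q x) = 0 := by
  have hmem : q a ∈ ratKrylov A b (poleList θ l) := by
    rw [← (hq.2 l (by omega)).2]
    refine ⟨Pi.single ⟨a, ha⟩ 1, ?_⟩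
    ext r
    simp [leadCols]
  obtain ⟨p, hp, hqa⟩ := hmem
  have hprod : poleProd (poleList θ (l + 1)) = poleProd (poleList θ l) := by
    rw [poleProd, Fin.prod_univ_castSucc]
    simp [poleList, hθ, poleFactor, poleProd]
  have hmem' : A *ᵥ q a ∈ ratKrylov A b (poleList θ (l + 1)) := by
    refine ⟨X * p, ?_, ?_⟩
    · rw [mem_degreeLT] at hp ⊢
      by_cases h0 : p = 0
      · simp [h0]
      · rw [degree_eq_natDegree h0] at hp
        rw [degree_mul, degree_X, degree_eq_natDegree h0]
        have : p.natDegree < l := by exact_mod_cast hp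
        exact_mod_cast (by omega : 1 + p.natDegree < l + 1)
    · have h1 := commute_aeval_inv A X (poleProd (poleList θ l))
      rw [aeval_X] at h1
      rw [hprod, hqa, map_mul, aeval_X, Matrix.mulVec_mulVec, h1, ← Matrix.mulVec_mulVec,
        Matrix.mulVec_mulVec _ A]
  rw [← (hq.2 (l + 1) (by omega)).2] at hmem'
  obtain ⟨c, hc⟩ := hmem'
  have horth : (leadCols q (l + 1))ᴴ *ᵥ q x = 0 := by
    ext y
    have h1 := congrFun (congrFun (hq.2 M le_rfl).1 ⟨y, by omega⟩) ⟨x, hx⟩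
    rw [Matrix.one_apply_ne (by simp only [ne_eq, Fin.mk.injEq]; omega)] at h1
    exact h1
  have h2 : star (q a) ⬝ᵥ (A *ᵥ q x) = star (A *ᵥ q a) ⬝ᵥ q x := by
    rw [star_mulVec, hA.eq, ← Matrix.dotProduct_mulVec]
  rw [h2, ← hc, star_mulVec, ← Matrix.dotProduct_mulVec, horth, dotProduct_zero]

/-- The first unit vector. -/
def firstUnit (l : ℕ) : Fin l → ℂ := fun c => if (c : ℕ) = 0 then 1 else 0

theorem star_firstUnit (l : ℕ) : star (firstUnit l) = firstUnit l := by
  ext c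
  simp [firstUnit, apply_ite]

/-- The matrix of a cycle, bordered by the uncompressed projection onto `q_N, …, q_{N+l-1}`. -/
def extendedMat {n k m : ℕ} (A : Matrix (Fin n) (Fin n) ℂ) (q : ℕ → Fin n → ℂ)
    (S : Matrix (Fin k ⊕ Fin m) (Fin k ⊕ Fin m) ℂ) (bt : Fin k ⊕ Fin m → ℂ) (N l : ℕ) :
    Matrix ((Fin k ⊕ Fin m) ⊕ Fin l) ((Fin k ⊕ Fin m) ⊕ Fin l) ℂ :=
  bordered S bt (firstUnit l)
    ((cols q fun c : Fin l => N + c)ᴴ * A * cols q fun c : Fin l => N + c)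

/-- The identification of the index sets `(k ⊕ m) ⊕ l` and `k ⊕ (m + l)`. -/
def shiftEquiv (k m l : ℕ) : (Fin k ⊕ Fin m) ⊕ Fin l ≃ Fin k ⊕ Fin (m + l) :=
  (Equiv.sumAssoc _ _ _).trans (Equiv.sumCongr (Equiv.refl _) finSumFinEquiv)

/-- The identification of the index sets `(k ⊕ m) ⊕ l` and `k + m + l`. -/
def flatEquiv (k m l : ℕ) : (Fin k ⊕ Fin m) ⊕ Fin l ≃ Fin (k + m + l) :=
  (Equiv.sumCongr finSumFinEquiv (Equiv.refl _)).trans finSumFinEquiv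

/-- This links consecutive cycles: compressing the old block and then absorbing the leading `m`
trailing vectors gives the next bordered matrix. `horth` reduces the coupling between the absorbed
block and the rest to a single column. -/
theorem bordered_submatrix_shiftEquiv {n k m l : ℕ} (hm : 1 ≤ m) {A : Matrix (Fin n) (Fin n) ℂ}
    (hA : A.IsHermitian) (f : RatFunc ℂ) (q : ℕ → Fin n → ℂ) (i : ℕ)
    (U : Matrix (Fin k ⊕ Fin m) (Fin k) ℂ) (st : CycleState n k m)
    (horth : ∀ c < m, ∀ x < l, 0 < x →
      star (q (k + i * m + c)) ⬝ᵥ (A *ᵥ q (k + i * m + m + x)) = 0) :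
    extendedMat A q (nextCycle A f q i U st).S (nextCycle A f q i U st).bt (k + (i + 1) * m) l =
      (bordered (Uᴴ * st.S * U) (Uᴴ *ᵥ st.bt) (firstUnit (m + l))
        ((cols q fun c : Fin (m + l) => k + i * m + c)ᴴ * A *
          cols q fun c : Fin (m + l) => k + i * m + c)).submatrix
        (shiftEquiv k m l) (shiftEquiv k m l) := by
  have hN : k + (i + 1) * m = k + i * m + m := by ring
  have hblock : block k m q i = cols q fun c : Fin m => k + i * m + c := rfl
  have hcross : ∀ (c : Fin m) (x : Fin l),
      star (q (k + i * m + c)) ⬝ᵥ (A *ᵥ q (k + i * m + (m + x))) =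
        star (q (k + i * m + c)) ⬝ᵥ (A *ᵥ q (k + i * m + m)) * firstUnit l x := by
    intro c x
    rw [firstUnit]
    split_ifs with hx
    · rw [hx, mul_one, add_zero]
    · rw [mul_zero, ← add_assoc]
      exact horth c c.2 x x.2 (Nat.pos_of_ne_zero hx)
  -- With `m` positive, the first unit vector of length `m + l` is supported in the absorbed block,
  -- so the compressed part does not couple to the later vectors.
  have hm0 : m ≠ 0 := by omega
  rw [hN]
  ext ((a | c) | x) ((a' | c') | x')
  · rfl
  · simp [extendedMat, bordered, nextCycle, shiftEquiv, vecMulVec_apply, star_firstUnit,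
      firstUnit]
  · simp [extendedMat, bordered, nextCycle, shiftEquiv, vecMulVec_apply, star_firstUnit,
      firstUnit, hm0]
  · simp [extendedMat, bordered, nextCycle, shiftEquiv, vecMulVec_apply, star_firstUnit,
      firstUnit]
  · simp [extendedMat, bordered, nextCycle, shiftEquiv, hblock, cols_gram_apply]
  · simp [-Matrix.mulVec_mulVec, extendedMat, bordered, nextCycle, shiftEquiv, vecMulVec_apply,
      star_firstUnit, hblock, cols_gram_apply, hcross, hN, cols_conjTranspose_mulVec_apply]
  · simp [extendedMat, bordered, nextCycle, shiftEquiv, vecMulVec_apply, star_firstUnit,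
      firstUnit, hm0]
  · simp only [extendedMat, bordered, nextCycle, shiftEquiv, vecMulVec_apply, star_firstUnit,
      hblock, cols_gram_apply, hN, cols_conjTranspose_mulVec_apply, fromBlocks_apply₂₁,
      conjTranspose_apply, Sum.elim_inr, submatrix_apply, Equiv.trans_apply,
      Equiv.sumAssoc_apply_inl_inr, Equiv.sumAssoc_apply_inr, Equiv.sumCongr_apply, Sum.map_inr,
      finSumFinEquiv_apply_left, finSumFinEquiv_apply_right, Fin.val_castAdd, Fin.val_natAdd,
      fromBlocks_apply₂₂]
    rw [← star_dotProduct_mulVec_symm hA (q (k + i * m + c')), hcross]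
  · simp [extendedMat, bordered, nextCycle, shiftEquiv, cols_gram_apply, add_assoc]

theorem extendedMat_firstCycle {n k m l : ℕ} {A : Matrix (Fin n) (Fin n) ℂ}
    (hA : A.IsHermitian) (b : Fin n → ℂ) (f : RatFunc ℂ) (q : ℕ → Fin n → ℂ)
    (horth : ∀ a < k + m, ∀ x < l, 0 < x → star (q a) ⬝ᵥ (A *ᵥ q (k + m + x)) = 0) :
    extendedMat A q (firstCycle k m A b f q).S (firstCycle k m A b f q).bt (k + m) l =
      (projMat A q (k + m + l)).submatrix (flatEquiv k m l) (flatEquiv k m l) := by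
  set g : Fin k ⊕ Fin m → ℕ := Sum.elim (fun a : Fin k => (a : ℕ)) fun c : Fin m => k + c with hg
  have hlead : leadCols q (k + m + l) = cols q fun c : Fin (k + m + l) => (c : ℕ) := rfl
  have hglt : ∀ a, g a < k + m := by
    rintro (a | c)
    · exact a.2.trans_le (Nat.le_add_right _ _)
    · exact Nat.add_lt_add_left c.2 k
  have hflat : ∀ a, ((flatEquiv k m l (Sum.inl a) : Fin (k + m + l)) : ℕ) = g a := by
    rintro (a | c) <;> simp [flatEquiv, hg]
  have hflat' : ∀ x, ((flatEquiv k m l (Sum.inr x) : Fin (k + m + l)) : ℕ) = k + m + x := by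
    intro x; simp [flatEquiv]
  have hcross : ∀ (a : Fin k ⊕ Fin m) (x : Fin l),
      star (q (g a)) ⬝ᵥ (A *ᵥ q (k + m + x)) =
        star (q (g a)) ⬝ᵥ (A *ᵥ q (k + m)) * firstUnit l x := by
    intro a x
    rw [firstUnit]
    split_ifs with hx
    · rw [hx, mul_one, add_zero]
    · rw [mul_zero]
      exact horth _ (hglt a) x x.2 (Nat.pos_of_ne_zero hx)
  ext (a | x) (a' | x')
  · simp [extendedMat, bordered, firstCycle, projMat, firstBlock_eq_cols, hlead, cols_gram_apply,
      hflat, ← hg]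
  · simp [-Matrix.mulVec_mulVec, extendedMat, bordered, firstCycle, projMat,
      firstBlock_eq_cols, hlead, cols_gram_apply, hflat, hflat', vecMulVec_apply, star_firstUnit,
      cols_conjTranspose_mulVec_apply, hcross, ← hg]
  · simp only [extendedMat, bordered, firstCycle, projMat, firstBlock_eq_cols, hlead,
      cols_gram_apply, submatrix_apply, fromBlocks_apply₂₁, conjTranspose_apply,
      hflat, hflat', vecMulVec_apply, star_firstUnit, cols_conjTranspose_mulVec_apply, ← hg]
    rw [← star_dotProduct_mulVec_symm hA (q (g a')), hcross]
  · simp [extendedMat, bordered, projMat, hlead, cols_gram_apply, hflat']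

/-! ### Induction over the cycles. -/

theorem isHermitian_cycle {n k m : ℕ} {A : Matrix (Fin n) (Fin n) ℂ} (hA : A.IsHermitian)
    (b : Fin n → ℂ) (f : RatFunc ℂ) (q : ℕ → Fin n → ℂ)
    (U : ℕ → Matrix (Fin k ⊕ Fin m) (Fin k) ℂ) (i : ℕ) :
    (cycle A b f q U (i + 1)).S.IsHermitian := by
  induction i with
  | zero => exact isHermitian_conjTranspose_mul_mul _ hA
  | succ i ih =>
    exact IsHermitian.fromBlocks (isHermitian_conjTranspose_mul_mul _ ih) rfl
      (isHermitian_conjTranspose_mul_mul _ hA)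

theorem fromCols_mulVec_elim_zero {ι κ μ : Type*} [Fintype ι] [Fintype κ] (V : Matrix μ ι ℂ)
    (R : Matrix μ κ ℂ) (x : ι → ℂ) : fromCols V R *ᵥ Sum.elim x 0 = V *ᵥ x := by
  simp [fromCols_mulVec]

theorem ratFun_extendedMat_zero {n k m : ℕ} (A : Matrix (Fin n) (Fin n) ℂ) (q : ℕ → Fin n → ℂ)
    (f : RatFunc ℂ) (st : CycleState n k m) (N : ℕ) :
    fromCols st.V (cols q fun c : Fin 0 => N + c) *ᵥ
        (ratFun f (extendedMat A q st.S st.bt N 0) *ᵥ Sum.elim st.v 0) =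
      st.V *ᵥ (ratFun f st.S *ᵥ st.v) := by
  let φ : (Fin k ⊕ Fin m) ⊕ Fin 0 ≃ Fin k ⊕ Fin m := Equiv.sumEmpty _ _
  have h1 : extendedMat A q st.S st.bt N 0 = st.S.submatrix φ φ := by
    ext (a | x) (a' | x')
    · rfl
    · exact x'.elim0
    · exact x.elim0
    · exact x.elim0
  have h2 : Sum.elim st.v (0 : Fin 0 → ℂ) = st.v ∘ φ := by
    ext (a | x)
    · rfl
    · exact x.elim0
  have h3 : fromCols st.V (cols q fun c : Fin 0 => N + c) = st.V.submatrix id φ := by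
    ext r (a | x)
    · rfl
    · exact x.elim0
  rw [h1, h2, h3, ratFun_submatrix_mulVec, mulVec_submatrix_comp]

/-- Here `j` counts the remaining cycles, and the starting cycle varies in the induction. The
correction `w` turns the `f(S)` term of one cycle into that of its compression, which makes the sum
telescope. -/
theorem cycle_add_y {n k m s : ℕ} (hm : 1 ≤ m) {A : Matrix (Fin n) (Fin n) ℂ}
    (hA : A.IsHermitian) {b : Fin n → ℂ} {θ : ℕ → OnePoint ℂ}
    (hθ : ∀ i, 1 ≤ i → i < s → θ (k + i * m) = OnePoint.infty) {q : ℕ → Fin n → ℂ}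
    (hq : IsRationalLanczosBasis A b θ (k + s * m) q) {ξ : Fin k → OnePoint ℂ}
    (hξ : ConjClosed ξ) {f : RatFunc ℂ} (hf : HasTypeWithPoles f ξ)
    {U : ℕ → Matrix (Fin k ⊕ Fin m) (Fin k) ℂ}
    (hU : ∀ i, 1 ≤ i → i < s → IsOrthonormalBasisOf (U i)
      (ratKrylov (cycle A b f q U i).S (cycle A b f q U i).bt ξ))
    (hS : ∀ i, 1 ≤ i → i ≤ s → PolesAvoid ξ (cycle A b f q U i).S)
    (hUS : ∀ i, 1 ≤ i → i < s → PolesAvoid ξ ((U i)ᴴ * (cycle A b f q U i).S * U i))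
    (j : ℕ) : ∀ i l, l = j * m → i + 1 + j ≤ s →
      PolesAvoid ξ (extendedMat A q (cycle A b f q U (i + 1)).S (cycle A b f q U (i + 1)).bt
        (k + (i + 1) * m) l) →
      (cycle A b f q U (i + 1 + j)).y = (cycle A b f q U (i + 1)).y -
        (cycle A b f q U (i + 1)).V *ᵥ
          (ratFun f (cycle A b f q U (i + 1)).S *ᵥ (cycle A b f q U (i + 1)).v) +
        fromCols (cycle A b f q U (i + 1)).V (cols q fun c : Fin l => k + (i + 1) * m + c) *ᵥ
          (ratFun f (extendedMat A q (cycle A b f q U (i + 1)).S (cycle A b f q U (i + 1)).bt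
            (k + (i + 1) * m) l) *ᵥ Sum.elim (cycle A b f q U (i + 1)).v 0) := by
  induction j with
  | zero =>
    intro i l hl _ _
    obtain rfl : l = 0 := by simpa using hl
    rw [ratFun_extendedMat_zero, add_zero, sub_add_cancel]
  | succ j ih =>
    intro i l hl hs hG
    -- This form of the length exposes the block absorbed next; keeping `l` separate from `j * m`
    -- allows the substitution inside the index types.
    obtain rfl : l = m + j * m := by rw [hl]; ring
    have hcyc : cycle A b f q U (i + 1 + 1) =
      nextCycle A f q (i + 1) (U (i + 1)) (cycle A b f q U (i + 1)) := rfl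
    have hSH := isHermitian_cycle hA b f q U i
    have hUi := hU (i + 1) (by omega) (by omega)
    have hSi := hS (i + 1) (by omega) (by omega)
    have hUSi := hUS (i + 1) (by omega) (by omega)
    have ih' := ih (i + 1) (j * m) rfl (by omega)
    rw [hcyc] at ih'
    set st := cycle A b f q U (i + 1)
    have hsub := bordered_submatrix_shiftEquiv (l := j * m) hm hA f q (i + 1) (U (i + 1)) st (by
      intro c hc x hx hx0
      have hN : k + (i + 1) * m + m = k + (i + 1 + 1) * m := by ring
      -- With `j = 0` no trailing vectors exist. Otherwise the next cycle is not the last, so the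
      -- pole at its end is infinite.
      have hj : j ≠ 0 := by rintro rfl; omega
      refine hq.dotProduct_eq_zero hA (hθ (i + 1 + 1) (by omega) (by omega)) ?_ ?_ ?_
      · rw [← hN]; omega
      · rw [← hN]; omega
      · have h1 : (i + 1 + (j + 1)) * m ≤ s * m := Nat.mul_le_mul_right m hs
        have h2 : (i + 1 + (j + 1)) * m = (i + 1) * m + m + j * m := by ring
        omega)
    have hG' := (polesAvoid_bordered_compress hUi hSi hUSi hG).submatrix (shiftEquiv k m (j * m))
    rw [← hsub] at hG'
    have hy := ih' hG'
    have hv : Sum.elim (nextCycle A f q (i + 1) (U (i + 1)) st).v (0 : Fin (j * m) → ℂ) =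
        Sum.elim ((U (i + 1))ᴴ *ᵥ st.v) (0 : Fin (m + j * m) → ℂ) ∘ shiftEquiv k m (j * m) := by
      ext ((a | c) | x) <;> rfl
    have hV : fromCols (nextCycle A f q (i + 1) (U (i + 1)) st).V
        (cols q fun c : Fin (j * m) => k + (i + 1 + 1) * m + c) =
        (fromCols (st.V * U (i + 1)) (cols q fun c : Fin (m + j * m) => k + (i + 1) * m + c)).submatrix
          id (shiftEquiv k m (j * m)) := by
      have hN : k + (i + 1 + 1) * m = k + (i + 1) * m + m := by ring
      ext r ((a | c) | x)
      · rfl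
      · simp [nextCycle, shiftEquiv, block, cols]
      · simp [shiftEquiv, cols, hN, add_assoc]
    rw [hsub, hv, hV, ratFun_submatrix_mulVec, mulVec_submatrix_comp] at hy
    have hext : fromCols st.V (cols q fun c : Fin (m + j * m) => k + (i + 1) * m + c) *
        extendOne (Fin (m + j * m)) (U (i + 1)) =
        fromCols (st.V * U (i + 1)) (cols q fun c : Fin (m + j * m) => k + (i + 1) * m + c) := by
      rw [extendOne, fromCols_mul_fromBlocks]
      simp
    rw [show i + 1 + (j + 1) = i + 1 + 1 + j by ring, hy, extendedMat,
      ratFun_bordered_compress hξ hf hSH hUi hSi hUSi hG, Matrix.mulVec_add,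
      fromCols_mulVec_elim_zero, Matrix.mulVec_mulVec _ _ (extendOne _ _), hext, Matrix.mulVec_sub,
      fromCols_mulVec_elim_zero]
    simp only [nextCycle]
    abel

end RKCompress

/-! ### Conclusion from the first cycle. -/

theorem mainTheorem1 {n k m s : ℕ} (hk : 1 ≤ k) (hm : 1 ≤ m)
    (A : Matrix (Fin n) (Fin n) ℂ) (hA : A.IsHermitian) (b : Fin n → ℂ)
    -- outer poles
    (θ : ℕ → OnePoint ℂ) (hθ0 : θ 0 = OnePoint.infty)
    (hθ : ∀ i, 1 ≤ i → i < s → θ (k + i * m) = OnePoint.infty)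
    (hθA : RKCompress.PolesAvoid (RKCompress.poleList θ (k + s * m)) A)
    -- outer basis
    (q : ℕ → Fin n → ℂ)
    (hq : RKCompress.IsRationalLanczosBasis A b θ (k + s * m) q)
    -- inner poles and the rational function
    (ξ : Fin k → OnePoint ℂ) (hξ : RKCompress.ConjClosed ξ)
    (f : RatFunc ℂ) (hf : RKCompress.HasTypeWithPoles f ξ)
    -- inner bases
    (U : ℕ → Matrix (Fin k ⊕ Fin m) (Fin k) ℂ)
    (hU : ∀ i, 1 ≤ i → i < s → RKCompress.IsOrthonormalBasisOf (U i)
      (RKCompress.ratKrylov (RKCompress.cycle A b f q U i).S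
        (RKCompress.cycle A b f q U i).bt ξ))
    -- the inner poles are not eigenvalues of the matrices at which `f` is evaluated
    (hT : ∀ i, 1 ≤ i → i ≤ s →
      RKCompress.PolesAvoid ξ (RKCompress.projMat A q (k + i * m)))
    (hS : ∀ i, 1 ≤ i → i ≤ s →
      RKCompress.PolesAvoid ξ (RKCompress.cycle A b f q U i).S)
    (hUS : ∀ i, 1 ≤ i → i < s →
      RKCompress.PolesAvoid ξ ((U i)ᴴ * (RKCompress.cycle A b f q U i).S * U i)) :
    ∀ i, 1 ≤ i → i ≤ s →
      (RKCompress.cycle A b f q U i).y = RKCompress.lanczosApprox A b f q (k + i * m) := by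
  intro r hr hrs
  obtain ⟨j, rfl⟩ := Nat.exists_eq_add_of_le hr
  have hlen : k + (1 + j) * m = k + m + j * m := by ring
  have hTr := hT (1 + j) hr hrs
  rw [hlen] at hTr ⊢
  have hcyc : RKCompress.cycle A b f q U 1 = RKCompress.firstCycle k m A b f q := rfl
  have hsub := RKCompress.extendedMat_firstCycle (k := k) (m := m) (l := j * m) hA b f q (by
    intro a ha x hx hx0
    have hj : j ≠ 0 := by rintro rfl; omega
    have h1 : (1 + j) * m ≤ s * m := Nat.mul_le_mul_right m hrs
    have h2 := hθ 1 le_rfl (by omega)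
    rw [one_mul] at h2
    exact hq.dotProduct_eq_zero hA h2 ha (by omega) (by omega))
  have hG := hTr.submatrix (RKCompress.flatEquiv k m (j * m))
  rw [← hsub] at hG
  have hy := RKCompress.cycle_add_y hm hA hθ hq hξ hf hU hS hUS j 0 (j * m) rfl (by omega)
  rw [zero_add, one_mul, hcyc] at hy
  have hy := hy hG
  have hv : Sum.elim (RKCompress.firstCycle k m A b f q).v (0 : Fin (j * m) → ℂ) =
      (fun a : Fin (k + m + j * m) => if (a : ℕ) = 0 then (RKCompress.norm2 b : ℂ) else 0) ∘
        RKCompress.flatEquiv k m (j * m) := by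
    -- Index `0` must fall in the leading block of `k` coordinates, where the starting vector has
    -- its nonzero entry.
    have hk0 : k ≠ 0 := by omega
    ext ((a | c) | x) <;> simp [RKCompress.firstCycle, RKCompress.flatEquiv, hk0]
  have hV : fromCols (RKCompress.firstCycle k m A b f q).V
      (RKCompress.cols q fun c : Fin (j * m) => k + m + c) =
      (RKCompress.leadCols q (k + m + j * m)).submatrix id (RKCompress.flatEquiv k m (j * m)) := by
    ext r ((a | c) | x) <;>
      simp [RKCompress.firstCycle, RKCompress.flatEquiv, RKCompress.cols, RKCompress.leadCols,
        RKCompress.firstBlock]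
  rw [hy, hsub, hv, hV, RKCompress.ratFun_submatrix_mulVec, RKCompress.mulVec_submatrix_comp,
    RKCompress.lanczosApprox]
  -- In the first cycle `y` equals `V f(S) v`, so the difference in front of the Lanczos term
  -- vanishes.
  simp [RKCompress.firstCycle]
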